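/- Let $M$ be a number of users, $[M]=\{1,\dots,M\}$. Let $W$ be a discrete memoryless $M$-user multiple-access channel with finite input alphabets $\mathcal X_1,\dots,\mathcal X_M$, finite output alphabet $\mathcal Y$ and transition probabilities $W(y\mid x_1,\dots,x_M)$, and let $X_1,\dots,X_M$ be independent inputs with distributions $P_{X_1},\dots,P_{X_M}$ and $Y$ the resulting output. For $\mathcal S\subseteq[M]$ and $R\in\mathbb R^M$ write $X_{\mathcal S}=(X_i)_{i\in\mathcal S}$, $R(\mathcal S)=\sum_{i\in\mathcal S}R_i$, $\mathcal S^c=[M]\setminus\mathcal S$, and let $$\mathcal R=\{R\in\mathbb R_+^M:\ R(\mathcal S)\le I(X_{\mathcal S};Y\mid X_{\mathcal S^c})\ \text{for all }\mathcal S\subseteq[M]\}.$$ Assume that $\mathcal R$ is non-degenerated, i.e. (1) $I(X_{\mathcal S};Y)>0$ for all non-empty $\mathcal S\subseteq[M]$, and (2) $I(X_{\mathcal S};Y\mid X_{\mathcal A})<I(X_{\mathcal S};Y\mid X_{\mathcal B})$ whenever $\emptyset\subsetneq\mathcal S\subsetneq[M]$, $\mathcal A\subsetneq\mathcal B\subsetneq[M]$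 and $\mathcal S\cap\mathcal B=\emptyset$. A face of $\mathcal R$ is a set $\mathcal R\cap\{R: R\cdot a=a_0\}$ where the inequality $R\cdot a\le a_0$ holds on all of $\mathcal R$; the dimension of a non-empty face is the dimension of its affine hull. For $\mathcal S\subseteq[M]$ let $\mathcal F_{\mathcal S}=\mathcal R\cap\{R: R(\mathcal S)=I(X_{\mathcal S};Y\mid X_{\mathcal S^c})\}$, and for $i\in[M]$ let $\mathcal B_i=\mathcal R\cap\{R:R_i=0\}$. For non-empty sets $\mathcal S_1,\dots,\mathcal S_m\subseteq[M]$ $(m\ge0)$ and $\mathcal A\subseteq[M]$ put $\mathcal F_{\mathcal S_1,\dots,\mathcal S_m\mid\mathcal A}=\mathcal R\cap\bigcap_j\mathcal F_{\mathcal S_j}\cap\bigcap_{i\in\mathcal A}\mathcal B_i$. A front face is a face of this form with $\mathcal A=\emptyset$. The dominant facet is $\mathcal F_{[M]}$. Let $0\le D\le M$. Let $N_f(M,D)$ be the number of front faces of dimension $D$ and, for $k\ge0$, let $N_d(M,k)$ be the number of $k$-dimensional faces of $\mathcal R$ contained in the dominant facet; put $N_d(M,-1)=0$. Then these numbers are finite,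 exactly $N_d(M,D)$ of the $D$-dimensional front faces are contained in the dominant facet, exactly $N_d(M,D-1)$ of them are not, and hence $$N_f(M,D)=N_d(M,D)+N_d(M,D-1).$$ -/

import Mathlib

noncomputable section

namespace MACRegion

universe u v

/-! ### Entropy and mutual information of finite random variables -/

section Information

variable {Ω α β γ : Type*} [Fintype Ω]

open Classical in
/-- The probability mass function of the random variable `f : Ω → α` when `Ω` carries the
probability mass function `p`. -/
def law (p : Ω → ℝ) (f : Ω → α) (a : α) : ℝ :=
  ∑ ω, if f ω = a then p ω else 0

/-- Shannon entropy `H(f) = -∑ a, P(f = a) log P(f = a)` (with `0 log 0 = 0`). -/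
def entropy [Fintype α] (p : Ω → ℝ) (f : Ω → α) : ℝ :=
  ∑ a, Real.negMulLog (law p f a)

/-- Mutual information `I(f; g) = H(f) + H(g) - H(f, g)`. -/
def mutualInfo [Fintype α] [Fintype β] (p : Ω → ℝ) (f : Ω → α) (g : Ω → β) : ℝ :=
  entropy p f + entropy p g - entropy p (fun ω => (f ω, g ω))

/-- Conditional mutual information
`I(f; g | h) = H(f | h) - H(f | g, h) = H(f, h) + H(g, h) - H(f, g, h) - H(h)`. -/
def condMutualInfo [Fintype α] [Fintype β] [Fintype γ]
    (p : Ω → ℝ) (f : Ω → α) (g : Ω → β) (h : Ω → γ) : ℝ :=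
  entropy p (fun ω => (f ω, h ω)) + entropy p (fun ω => (g ω, h ω))
    - entropy p (fun ω => (f ω, g ω, h ω)) - entropy p h

end Information

/-! ### The multiple-access channel

The set of users is `Fin M`. User `i` has the finite input alphabet `X i`, and `Y` is the finite
output alphabet. The channel is a stochastic matrix `W`: for each input tuple `x`, `W x` is a
probability vector on `Y`. The input distribution is in product form, with marginals `P i`. -/

section Channel

variable {M : ℕ} {X : Fin M → Type u} {Y : Type v} [∀ i, Fintype (X i)] [Fintype Y]

/-- The joint probability mass function of `(X_1, …, X_M, Y)`. -/
def jointLaw (W : (∀ i, X i) → stdSimplex ℝ Y) (P : ∀ i, stdSimplex ℝ (X i)) :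
    (∀ i, X i) × Y → ℝ :=
  fun ω => (∏ i, (P i : X i → ℝ) (ω.1 i)) * (W ω.1 : Y → ℝ) ω.2

/-- The random variable `X_S = (X_i)_{i ∈ S}`. -/
def inputs (S : Finset (Fin M)) (ω : (∀ i, X i) × Y) : ∀ i : S, X i :=
  fun i => ω.1 i

/-- `I(X_S; Y)`. -/
def info (W : (∀ i, X i) → stdSimplex ℝ Y) (P : ∀ i, stdSimplex ℝ (X i))
    (S : Finset (Fin M)) : ℝ :=
  mutualInfo (jointLaw W P) (inputs S) Prod.snd

/-- `I(X_S; Y | X_A)`. -/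
def condInfo (W : (∀ i, X i) → stdSimplex ℝ Y) (P : ∀ i, stdSimplex ℝ (X i))
    (S A : Finset (Fin M)) : ℝ :=
  condMutualInfo (jointLaw W P) (inputs S) Prod.snd (inputs A)

/-- The polytope
`𝓡 = {R ∈ ℝ₊^M : R(S) ≤ I(X_S; Y | X_{Sᶜ}) for all S ⊆ [M]}`, where `R(S) = ∑ i ∈ S, R i`. -/
def region (W : (∀ i, X i) → stdSimplex ℝ Y) (P : ∀ i, stdSimplex ℝ (X i)) :
    Set (Fin M → ℝ) :=
  {R | (∀ i, 0 ≤ R i) ∧ ∀ S : Finset (Fin M), ∑ i ∈ S, R i ≤ condInfo W P S Sᶜ}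

/-- The region is non-degenerated: every group of inputs carries information, and all inputs
interfere with one another. -/
structure NonDegenerated (W : (∀ i, X i) → stdSimplex ℝ Y) (P : ∀ i, stdSimplex ℝ (X i)) :
    Prop where
  info_pos : ∀ S : Finset (Fin M), S.Nonempty → 0 < info W P S
  condInfo_lt : ∀ S A B : Finset (Fin M), S.Nonempty → S ⊂ Finset.univ → A ⊂ B →
    B ⊂ Finset.univ → Disjoint S B → condInfo W P S A < condInfo W P S B

/-! ### Faces -/

/-- `F` is a face of `Q`: the part of `Q` on which some valid linear inequality `R a ≤ a₀` is an
equality. -/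
def IsFaceOf (Q F : Set (Fin M → ℝ)) : Prop :=
  ∃ (a : Fin M → ℝ) (a₀ : ℝ), (∀ R ∈ Q, R ⬝ᵥ a ≤ a₀) ∧ F = Q ∩ {R | R ⬝ᵥ a = a₀}

/-- `F` is non-empty and the dimension of its affine hull is `D`. In particular no set has
negative dimension: the empty set is given no dimension at all. -/
def HasDim (F : Set (Fin M → ℝ)) (D : ℤ) : Prop :=
  F.Nonempty ∧ (Module.finrank ℝ (affineSpan ℝ F).direction : ℤ) = D

/-- The back facet `𝓑_i = 𝓡 ∩ {R : R_i = 0}`. -/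
def backFacet (W : (∀ i, X i) → stdSimplex ℝ Y) (P : ∀ i, stdSimplex ℝ (X i)) (i : Fin M) :
    Set (Fin M → ℝ) :=
  region W P ∩ {R | R i = 0}

/-- The front facet `𝓕_S = 𝓡 ∩ {R : R(S) = I(X_S; Y | X_{Sᶜ})}`. -/
def frontFacet (W : (∀ i, X i) → stdSimplex ℝ Y) (P : ∀ i, stdSimplex ℝ (X i))
    (S : Finset (Fin M)) : Set (Fin M → ℝ) :=
  region W P ∩ {R | ∑ i ∈ S, R i = condInfo W P S Sᶜ}

/-- The dominant facet `𝓕_{[M]}`. -/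
def dominantFacet (W : (∀ i, X i) → stdSimplex ℝ Y) (P : ∀ i, stdSimplex ℝ (X i)) :
    Set (Fin M → ℝ) :=
  frontFacet W P Finset.univ

/-- `𝓕_{S_1, …, S_m | A}`, the intersection of the front facets `𝓕_{S_j}` and of the back facets
`𝓑_i`, `i ∈ A`, where `𝒮 = {S_1, …, S_m}`. It is `𝓡` when `𝒮` and `A` are both empty. -/
def labelled (W : (∀ i, X i) → stdSimplex ℝ Y) (P : ∀ i, stdSimplex ℝ (X i))
    (𝒮 : Finset (Finset (Fin M))) (A : Finset (Fin M)) : Set (Fin M → ℝ) :=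
  region W P ∩ (⋂ S ∈ 𝒮, frontFacet W P S) ∩ ⋂ i ∈ A, backFacet W P i

/-- A front face is a face of the form `𝓕_{S_1, …, S_m | A}` with `A = ∅`, where the `S_j` are
non-empty sets of users. -/
def IsFrontFace (W : (∀ i, X i) → stdSimplex ℝ Y) (P : ∀ i, stdSimplex ℝ (X i))
    (F : Set (Fin M → ℝ)) : Prop :=
  IsFaceOf (region W P) F ∧
    ∃ 𝒮 : Finset (Finset (Fin M)), (∀ S ∈ 𝒮, S.Nonempty) ∧ F = labelled W P 𝒮 ∅

/-- The front faces of dimension `D`. -/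
def frontFaces (W : (∀ i, X i) → stdSimplex ℝ Y) (P : ∀ i, stdSimplex ℝ (X i)) (D : ℤ) :
    Set (Set (Fin M → ℝ)) :=
  {F | IsFrontFace W P F ∧ HasDim F D}

/-- The faces of `𝓡` of dimension `D` that lie in the dominant facet. -/
def dominantFaces (W : (∀ i, X i) → stdSimplex ℝ Y) (P : ∀ i, stdSimplex ℝ (X i)) (D : ℤ) :
    Set (Set (Fin M → ℝ)) :=
  {F | IsFaceOf (region W P) F ∧ HasDim F D ∧ F ⊆ dominantFacet W P}

/-- `N_f(M, D)`, the number of front faces of dimension `D`. -/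
def numFront (W : (∀ i, X i) → stdSimplex ℝ Y) (P : ∀ i, stdSimplex ℝ (X i)) (D : ℤ) : ℕ :=
  (frontFaces W P D).ncard

/-- `N_d(M, D)`, the number of faces of dimension `D` in the dominant facet; it is `0` for
`D = -1`. -/
def numDominant (W : (∀ i, X i) → stdSimplex ℝ Y) (P : ∀ i, stdSimplex ℝ (X i)) (D : ℤ) : ℕ :=
  (dominantFaces W P D).ncard

end Channel

end MACRegion

end

/-! With `f S = I(X_S; Y | X_{Sᶜ})`, the chain rule turns non-degeneracy into two properties of `f`:
strict submodularity on incomparable pairs, and a strict increase from `[M] \ {i}` to `[M]`. Only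
these are used afterwards.

Strict submodularity forbids two incomparable constraints from being tight at a common point, so a
non-empty front face comes from a chain of non-empty sets (`isFlag_of_nonempty_face`). Conversely
every chain `C` has a point with positive coordinates at which exactly the constraints of `C` are
tight (`IsFlag.exists_isGeneric`): a greedy vertex realises a maximal chain, and small moves release
the surplus constraints. Hence front faces correspond bijectively to chains, inclusion is reversed,
and the dimension is that of the space of directions keeping `C` tight.

All coordinates are positive on the dominant facet, so every non-empty face inside it is a front
face (`exists_eq_face`), namely one whose chain contains `[M]`. Adding `[M]` to a chain without it
lowers the dimension by one and is inverted by deleting `[M]`; geometrically, this is intersection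
with the dominant facet (`inter_dominantFacet_bijOn`). -/

namespace MACRegion

/-! ### Entropy is invariant under injective relabelling. -/

section Information

open Classical in
theorem law_comp_apply {Ω α β : Type*} [Fintype Ω] (p : Ω → ℝ) (f : Ω → α) {e : α → β}
    (he : e.Injective) (a : α) : law p (fun ω => e (f ω)) (e a) = law p f a := by
  simp [law, he.eq_iff]

theorem entropy_comp_of_injective {Ω α β : Type*} [Fintype Ω] [Fintype α] [Fintype β]
    (p : Ω → ℝ) (f : Ω → α) {e : α → β} (he : e.Injective) :
    entropy p (fun ω => e (f ω)) = entropy p f := by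
  classical
  unfold entropy
  have h0 : ∀ b ∉ Finset.univ.image e, Real.negMulLog (law p (fun ω => e (f ω)) b) = 0 := by
    intro b hb
    have : law p (fun ω => e (f ω)) b = 0 := by
      unfold law
      refine Finset.sum_eq_zero fun ω _ => if_neg ?_
      rintro rfl
      exact hb (Finset.mem_image_of_mem _ (Finset.mem_univ _))
    simp [this]
  rw [← Finset.sum_subset (Finset.subset_univ (Finset.univ.image e)) fun b _ hb => h0 b hb,
    Finset.sum_image he.injOn]
  exact Finset.sum_congr rfl fun a _ => by rw [law_comp_apply p f he]

theorem entropy_eq_of_injective {Ω α β : Type*} [Fintype Ω] [Fintype α] [Fintype β]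
    (p : Ω → ℝ) (f : Ω → α) (g : Ω → β) {e : α → β} (he : e.Injective)
    (hg : ∀ ω, g ω = e (f ω)) : entropy p g = entropy p f := by
  rw [funext hg, entropy_comp_of_injective p f he]

theorem entropy_of_unique {Ω α : Type*} [Fintype Ω] [Fintype α] [Unique α] {p : Ω → ℝ}
    (hp : ∑ ω, p ω = 1) (f : Ω → α) : entropy p f = 0 := by
  have : law p f default = 1 := by
    unfold law
    rw [← hp]
    exact Finset.sum_congr rfl fun ω _ => if_pos (Subsingleton.elim _ _)
  simp [entropy, this]

end Information

theorem injective_restrict_union {M : ℕ} {X : Fin M → Type*} (S A : Finset (Fin M)) :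
    Function.Injective (fun (x : ∀ i : (S ∪ A : Finset (Fin M)), X i) =>
      ((fun i : S => x ⟨i, Finset.mem_union_left _ i.2⟩ : ∀ i : S, X i),
        (fun i : A => x ⟨i, Finset.mem_union_right _ i.2⟩ : ∀ i : A, X i))) := by
  intro x y hxy
  obtain ⟨h1, h2⟩ := Prod.ext_iff.1 hxy
  funext ⟨i, hi⟩
  rcases Finset.mem_union.1 hi with h | h
  · exact congrFun h1 ⟨i, h⟩
  · exact congrFun h2 ⟨i, h⟩

/-! ### Mutual informations as differences of conditional output entropies. -/

section Channel

variable {M : ℕ} {X : Fin M → Type*} {Y : Type*} [∀ i, Fintype (X i)] [Fintype Y]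
  (W : (∀ i, X i) → stdSimplex ℝ Y) (P : ∀ i, stdSimplex ℝ (X i))

theorem sum_jointLaw : ∑ ω, jointLaw W P ω = 1 := by
  classical
  simp only [jointLaw, Fintype.sum_prod_type, ← Finset.mul_sum]
  have h1 : ∀ x, ∑ y, (W x : Y → ℝ) y = 1 := fun x => (W x).2.2
  have h2 : ∀ i, ∑ a, (P i : X i → ℝ) a = 1 := fun i => (P i).2.2
  simp only [h1, mul_one]
  rw [← Fintype.prod_sum]
  simp [h2]

/-- `-H(Y | X_A)`. -/
noncomputable def negCondEntropy (A : Finset (Fin M)) : ℝ :=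
  entropy (jointLaw W P) (inputs A) -
    entropy (jointLaw W P) (fun ω => (inputs A ω, ω.2))

/-- The pair `(X_S, X_A)` is an injective relabelling of `X_{S ∪ A}`, even when `S` and `A` overlap,
so this is `H(Y | X_A) - H(Y | X_{S ∪ A})`. -/
theorem condInfo_eq (S A : Finset (Fin M)) :
    condInfo W P S A = negCondEntropy W P (S ∪ A) - negCondEntropy W P A := by
  have hinj := injective_restrict_union (X := X) S A
  have e1 : entropy (jointLaw W P) (fun ω => (inputs S ω, inputs A ω)) =
      entropy (jointLaw W P) (inputs (S ∪ A)) :=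
    entropy_eq_of_injective _ _ _ hinj fun _ => rfl
  have e2 : entropy (jointLaw W P) (fun ω => (ω.2, inputs A ω)) =
      entropy (jointLaw W P) (fun ω => (inputs A ω, ω.2)) :=
    entropy_eq_of_injective _ _ _ Prod.swap_injective fun _ => rfl
  have e3 : entropy (jointLaw W P) (fun ω => (inputs S ω, ω.2, inputs A ω)) =
      entropy (jointLaw W P) (fun ω => (inputs (S ∪ A) ω, ω.2)) :=
    entropy_eq_of_injective _ _ _
      (e := fun z : (∀ i : (S ∪ A : Finset (Fin M)), X i) × Y =>
        (((fun i : S => z.1 ⟨i, Finset.mem_union_left _ i.2⟩ : ∀ i : S, X i)), z.2,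
          (fun i : A => z.1 ⟨i, Finset.mem_union_right _ i.2⟩ : ∀ i : A, X i))) (by
        rintro ⟨x, u⟩ ⟨y, w⟩ h
        simp only [Prod.mk.injEq] at h
        exact Prod.ext (hinj (Prod.ext h.1 h.2.2)) h.2.1) fun _ => rfl
  unfold condInfo condMutualInfo negCondEntropy
  rw [e1, e2, e3]
  ring

theorem info_eq (S : Finset (Fin M)) :
    info W P S = negCondEntropy W P S - negCondEntropy W P ∅ := by
  have e1 := entropy_of_unique (sum_jointLaw W P) (inputs (∅ : Finset (Fin M)))
  have e2 := entropy_comp_of_injective (jointLaw W P) Prod.snd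
    (e := fun y : Y => ((fun i => isEmptyElim i : ∀ i : (∅ : Finset (Fin M)), X i), y))
    (fun y z h => (Prod.ext_iff.1 h).2)
  have e3 : entropy (jointLaw W P) (fun ω => (inputs (∅ : Finset (Fin M)) ω, ω.2)) =
      entropy (jointLaw W P) Prod.snd := by
    rw [← e2]
    congr 1
    funext ω
    exact Prod.ext (Subsingleton.elim _ _) rfl
  unfold info mutualInfo negCondEntropy
  rw [e1, e3]
  ring

end Channel

/-- A set function with `f ∅ = 0` that is strictly submodular on incomparable pairs and strictly
increasing at the top. -/
structure StrictPolymatroid {M : ℕ} (f : Finset (Fin M) → ℝ) : Prop where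
  map_empty : f ∅ = 0
  submodular : ∀ S T, ¬ S ⊆ T → ¬ T ⊆ S → f (S ∪ T) + f (S ∩ T) < f S + f T
  erase_lt : ∀ i, f (Finset.univ.erase i) < f Finset.univ

theorem NonDegenerated.strictPolymatroid {M : ℕ} {X : Fin M → Type*} {Y : Type*}
    [∀ i, Fintype (X i)] [Fintype Y] {W : (∀ i, X i) → stdSimplex ℝ Y}
    {P : ∀ i, stdSimplex ℝ (X i)} (h : NonDegenerated W P) :
    StrictPolymatroid fun S => condInfo W P S Sᶜ where
  map_empty := by simp [condInfo_eq]
  submodular S T hST hTS := by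
    have hST' := Finset.sdiff_nonempty.2 hST
    have hTS' := Finset.sdiff_nonempty.2 hTS
    obtain ⟨i, hi⟩ := hST'
    obtain ⟨j, hj⟩ := hTS'
    rw [Finset.mem_sdiff] at hi hj
    -- After complementation this says that adding `T \ S` to `S` gains strictly less than adding it
    -- to `S ∩ T`.
    have key := h.condInfo_lt (T \ S) (S ∪ T)ᶜ Tᶜ ⟨j, by simp [hj]⟩
      ((Finset.ssubset_univ_iff).2 fun e => by
        have : i ∈ T \ S := by rw [e]; exact Finset.mem_univ i
        simp [hi.1] at this)
      (Finset.ssubset_iff_of_subset (by intro x; simp) |>.2 ⟨i, by simp [hi]⟩)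
      ((Finset.ssubset_univ_iff).2 fun e => by
        have : j ∈ Tᶜ := by rw [e]; exact Finset.mem_univ j
        simp [hj.1] at this)
      (Finset.disjoint_left.2 fun x hx => by simp at hx ⊢; exact hx.1)
    have e1 : T \ S ∪ (S ∪ T)ᶜ = Sᶜ := by ext x; simp; tauto
    have e2 : T \ S ∪ Tᶜ = (S ∩ T)ᶜ := by ext x; simp; tauto
    simp only [condInfo_eq, Finset.union_compl, e1, e2] at key ⊢
    linarith
  erase_lt i := by
    have key := h.info_pos {i} ⟨i, by simp⟩
    have e : (Finset.univ.erase i)ᶜ = {i} := by ext x; simp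
    simp only [condInfo_eq, info_eq, Finset.union_compl, Finset.compl_univ, Finset.union_empty]
      at key ⊢
    rw [e]
    linarith

open Filter Topology

/-! ### Chains of tight constraints and generic points. -/

section Polytope

variable {M : ℕ} {f : Finset (Fin M) → ℝ}

/-- By submodularity the gain from adding `i` is smallest at `[M] \ {i}`, where it is positive by
assumption. -/
theorem StrictPolymatroid.lt_insert (hf : StrictPolymatroid f) {A : Finset (Fin M)} {i : Fin M}
    (hi : i ∉ A) : f A < f (insert i A) := by
  by_cases h : insert i A = Finset.univ
  · have : A = Finset.univ.erase i := by rw [← h, Finset.erase_insert hi]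
    rw [h, this]
    exact hf.erase_lt i
  · have h1 : insert i A ∪ Finset.univ.erase i = Finset.univ := by
      ext x; by_cases hx : x = i <;> simp [hx]
    have h2 : insert i A ∩ Finset.univ.erase i = A := by
      ext x; by_cases hx : x = i <;> simp [hx, hi]
    have key := hf.submodular (insert i A) (Finset.univ.erase i)
      (fun hs => by simpa using hs (Finset.mem_insert_self i A))
      (fun hs => h (by rw [← h1]; exact (Finset.union_eq_left.2 hs).symm))
    rw [h1, h2] at key
    linarith [hf.erase_lt i]

/-- A point of the polytope with positive coordinates at which the tight constraints are exactly
those of the family `C`. -/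
structure IsGeneric (f : Finset (Fin M) → ℝ) (C : Finset (Finset (Fin M))) (p : Fin M → ℝ) :
    Prop where
  pos : ∀ i, 0 < p i
  sum_eq : ∀ S ∈ C, ∑ i ∈ S, p i = f S
  sum_lt : ∀ S : Finset (Fin M), S.Nonempty → S ∉ C → ∑ i ∈ S, p i < f S

/-- Non-empty sets, pairwise comparable. -/
structure IsFlag (C : Finset (Finset (Fin M))) : Prop where
  nonempty : ∀ S ∈ C, S.Nonempty
  comparable : ∀ S ∈ C, ∀ T ∈ C, S ⊆ T ∨ T ⊆ S

theorem IsFlag.mono {C C' : Finset (Finset (Fin M))} (h : IsFlag C') (hC : C ⊆ C') : IsFlag C :=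
  ⟨fun S hS => h.nonempty S (hC hS), fun S hS T hT => h.comparable S (hC hS) T (hC hT)⟩

theorem sum_add_smul (S : Finset (Fin M)) (p v : Fin M → ℝ) (ε : ℝ) :
    ∑ i ∈ S, (p + ε • v) i = ∑ i ∈ S, p i + ε * ∑ i ∈ S, v i := by
  simp [Finset.sum_add_distrib, Finset.mul_sum]

theorem eventually_lt_add_mul {a b : ℝ} (c : ℝ) (h : a < b) :
    ∀ᶠ ε : ℝ in 𝓝[>] 0, a + ε * c < b := by
  have : Tendsto (fun ε : ℝ => a + ε * c) (𝓝 0) (𝓝 (a + 0 * c)) :=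
    (continuous_const.add (continuous_id.mul continuous_const)).tendsto 0
  exact (this.mono_left nhdsWithin_le_nhds).eventually_lt_const (by simpa using h)

theorem IsGeneric.eventually_perturb {C : Finset (Finset (Fin M))} {p : Fin M → ℝ}
    (hp : IsGeneric f C p) (v : Fin M → ℝ) :
    ∀ᶠ ε : ℝ in 𝓝[>] 0, (∀ i, 0 < (p + ε • v) i) ∧
      ∀ S : Finset (Fin M), S.Nonempty → S ∉ C → ∑ i ∈ S, (p + ε • v) i < f S := by
  refine Filter.Eventually.and (Filter.eventually_all.2 fun i => ?_)
    (Filter.eventually_all.2 fun S => ?_)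
  · filter_upwards [eventually_lt_add_mul (-v i) (neg_lt_zero.2 (hp.pos i))] with ε h
    simp only [Pi.add_apply, Pi.smul_apply, smul_eq_mul]
    linarith
  · by_cases h : S.Nonempty ∧ S ∉ C
    · filter_upwards [eventually_lt_add_mul (∑ i ∈ S, v i) (hp.sum_lt S h.1 h.2)] with ε h _ _
      rwa [sum_add_smul]
    · exact Filter.Eventually.of_forall fun ε h1 h2 => (h ⟨h1, h2⟩).elim

/-- Take `i` in `T` but not in the preceding member of the chain, and `j` in the following member
but not in `T`. Every member other than `T` contains both or neither, so `e_j - e_i` works; if `T`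
is the largest member, `-e_i` does. -/
theorem IsFlag.exists_direction {C : Finset (Finset (Fin M))} (hC : IsFlag C)
    {T : Finset (Fin M)} (hT : T ∈ C) :
    ∃ v : Fin M → ℝ, (∀ S ∈ C, S ≠ T → ∑ i ∈ S, v i = 0) ∧ ∑ i ∈ T, v i < 0 := by
  have hi : ∃ i ∈ T, ∀ S ∈ C, S ⊂ T → i ∉ S := by
    by_cases h : ∃ S, S ∈ C ∧ S ⊂ T
    · obtain ⟨S₀, hS₀, hmax⟩ := Finset.exists_maximal (s := C.filter (· ⊂ T))
        ⟨h.choose, by simpa using h.choose_spec⟩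
      obtain ⟨h1, h2⟩ := Finset.mem_filter.1 hS₀
      obtain ⟨i, hiT, hiS⟩ := Finset.exists_of_ssubset h2
      refine ⟨i, hiT, fun S hS hST his => hiS ?_⟩
      rcases hC.comparable S hS S₀ h1 with h | h
      · exact h his
      · exact hmax (Finset.mem_filter.2 ⟨hS, hST⟩) h his
    · obtain ⟨i, hi⟩ := hC.nonempty T hT
      exact ⟨i, hi, fun S hS hST => (h ⟨S, hS, hST⟩).elim⟩
  obtain ⟨i, hiT, hi⟩ := hi
  by_cases h : ∃ S, S ∈ C ∧ T ⊂ S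
  · obtain ⟨S₀, hS₀, hmin⟩ := Finset.exists_minimal (s := C.filter (T ⊂ ·))
      ⟨h.choose, by simpa using h.choose_spec⟩
    obtain ⟨h1, h2⟩ := Finset.mem_filter.1 hS₀
    obtain ⟨j, hjS, hjT⟩ := Finset.exists_of_ssubset h2
    refine ⟨Pi.single j 1 - Pi.single i 1, fun S hS hST => ?_, ?_⟩
    · rcases hC.comparable S hS T hT with h | h
      · have h3 : j ∉ S := fun hj => hjT (h hj)
        simp [h3, hi S hS (h.ssubset_of_ne hST)]
      · have hS₀ : S₀ ⊆ S := by
          rcases hC.comparable S hS S₀ h1 with h' | h'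
          · exact hmin (Finset.mem_filter.2 ⟨hS, h.ssubset_of_ne hST.symm⟩) h'
          · exact h'
        simp [hS₀ hjS, h hiT]
    · simp [hiT, hjT]
  · refine ⟨-Pi.single i 1, fun S hS hST => ?_, by simp [hiT]⟩
    rcases hC.comparable S hS T hT with h' | h'
    · simp [hi S hS (h'.ssubset_of_ne hST)]
    · exact (h ⟨S, hS, h'.ssubset_of_ne hST.symm⟩).elim

theorem IsFlag.exists_isGeneric_erase {C : Finset (Finset (Fin M))} (hC : IsFlag C)
    {p : Fin M → ℝ} (hp : IsGeneric f C p) (T : Finset (Fin M)) :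
    ∃ q, IsGeneric f (C.erase T) q := by
  by_cases hT : T ∈ C
  swap
  · exact ⟨p, by rwa [Finset.erase_eq_of_notMem hT]⟩
  obtain ⟨v, hv0, hvT⟩ := hC.exists_direction hT
  obtain ⟨ε, ⟨h1, h2⟩, hε⟩ := ((hp.eventually_perturb v).and self_mem_nhdsWithin).exists
  refine ⟨p + ε • v, h1, fun S hS => ?_, fun S hS hSC => ?_⟩
  · rw [Finset.mem_erase] at hS
    rw [sum_add_smul, hv0 S hS.2 hS.1, hp.sum_eq S hS.2, mul_zero, add_zero]
  · by_cases hS' : S ∈ C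
    · obtain rfl : S = T := by
        by_contra h
        exact hSC (Finset.mem_erase.2 ⟨h, hS'⟩)
      rw [sum_add_smul, hp.sum_eq S hS']
      have := mul_neg_of_pos_of_neg (Set.mem_Ioi.1 hε) hvT
      linarith
    · exact h2 S hS hS'

theorem IsFlag.exists_isGeneric_of_subset {C C' : Finset (Finset (Fin M))} (hC' : IsFlag C')
    (hCC' : C ⊆ C') (h : ∃ p, IsGeneric f C' p) : ∃ p, IsGeneric f C p := by
  have key : ∀ E : Finset (Finset (Fin M)), ∃ p, IsGeneric f (C' \ E) p := by
    intro E
    induction E using Finset.induction_on with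
    | empty => simpa using h
    | insert T E _ ih =>
      obtain ⟨p, hp⟩ := ih
      rw [Finset.sdiff_insert]
      exact (hC'.mono Finset.sdiff_subset).exists_isGeneric_erase hp T
  simpa [Finset.sdiff_sdiff_eq_self hCC'] using key (C' \ C)

/-! ### Greedy vertices. -/

section Greedy

variable {κ : Type*} [LinearOrder κ]

/-- The users that come no later than `i` in the order given by `k`. -/
def initialSet (k : Fin M → κ) (i : Fin M) : Finset (Fin M) :=
  Finset.univ.filter fun j => k j ≤ k i

/-- The greedy vertex for the order given by `k`. -/
noncomputable def greedy (f : Finset (Fin M) → ℝ) (k : Fin M → κ) (i : Fin M) : ℝ :=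
  f (initialSet k i) - f ((initialSet k i).erase i)

theorem mem_initialSet {k : Fin M → κ} {i j : Fin M} : j ∈ initialSet k i ↔ k j ≤ k i := by
  simp [initialSet]

theorem StrictPolymatroid.greedy_pos (hf : StrictPolymatroid f) (k : Fin M → κ) (i : Fin M) :
    0 < greedy f k i := by
  have := hf.lt_insert (Finset.notMem_erase i (initialSet k i))
  rw [Finset.insert_erase (mem_initialSet.2 le_rfl)] at this
  exact sub_pos.2 this

/-- Remove the last user `i` of `S` and induct. If `S` is an initial segment, the sum telescopes;
otherwise `S` and the users strictly before `i` are incomparable, and submodularity is strict. The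
middle bound is what the induction needs, since `S.erase i` may be of either kind. -/
theorem StrictPolymatroid.sum_greedy (hf : StrictPolymatroid f) {k : Fin M → κ}
    (hk : k.Injective) (S : Finset (Fin M)) :
    ((∀ i ∈ S, ∀ j, k j ≤ k i → j ∈ S) → ∑ i ∈ S, greedy f k i = f S) ∧
    ∑ i ∈ S, greedy f k i ≤ f S ∧
    ((¬ ∀ i ∈ S, ∀ j, k j ≤ k i → j ∈ S) → ∑ i ∈ S, greedy f k i < f S) := by
  induction S using Finset.strongInduction with
  | H S ih =>
    rcases S.eq_empty_or_nonempty with rfl | hS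
    · simp [hf.map_empty]
    obtain ⟨i, hiS, hmax⟩ := S.exists_max_image k hS
    have hsub : S ⊆ initialSet k i := fun j hj => mem_initialSet.2 (hmax j hj)
    have hih := ih (S.erase i) (Finset.erase_ssubset hiS)
    have hsum := Finset.add_sum_erase S (greedy f k) hiS
    by_cases hlow : S = initialSet k i
    · have hSlow : ∀ a ∈ S, ∀ j, k j ≤ k a → j ∈ S := fun a ha j hj => by
        rw [hlow]; exact mem_initialSet.2 (hj.trans (hmax a ha))
      have heq : ∑ a ∈ S, greedy f k a = f S := by
        rw [← hsum, hih.1, greedy, ← hlow]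
        · ring
        · intro a ha j hj
          rw [Finset.mem_erase] at ha ⊢
          refine ⟨?_, hSlow a ha.2 j hj⟩
          rintro rfl
          exact ha.1 (hk (le_antisymm (hmax a ha.2) hj))
      exact ⟨fun _ => heq, heq.le, fun h => (h hSlow).elim⟩
    · have hnot : ¬ ∀ a ∈ S, ∀ j, k j ≤ k a → j ∈ S := fun h =>
        hlow (hsub.antisymm fun j hj => h i hiS j (mem_initialSet.1 hj))
      have hu : S ∪ (initialSet k i).erase i = initialSet k i := by
        ext x
        by_cases hx : x = i
        · simp [hx, hiS, mem_initialSet]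
        · simpa [hx] using fun h => hsub h
      have hn : S ∩ (initialSet k i).erase i = S.erase i := by
        ext x
        have := @hsub x
        simp only [Finset.mem_inter, Finset.mem_erase]
        tauto
      have hsm := hf.submodular S ((initialSet k i).erase i)
        (fun h => by simpa using h hiS)
        (fun h => hlow (by rw [← hu]; exact (Finset.union_eq_left.2 h).symm))
      rw [hu, hn] at hsm
      have hlt : ∑ a ∈ S, greedy f k a < f S := by
        have h1 := hih.2.1
        have h2 : greedy f k i = f (initialSet k i) - f ((initialSet k i).erase i) := rfl
        linarith
      exact ⟨fun h => (hnot h).elim, hlt.le, fun _ => hlt⟩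

end Greedy

theorem IsFlag.exists_isGeneric (hf : StrictPolymatroid f) {C : Finset (Finset (Fin M))}
    (hC : IsFlag C) : ∃ p, IsGeneric f C p := by
  classical
  -- Users missed by fewer members of `C` come first, so each member of `C` is an initial segment;
  -- the index breaks ties. `C'` is the chain of all non-empty initial segments.
  let k : Fin M → ℕ ×ₗ Fin M := fun i => toLex ((C.filter fun T => i ∉ T).card, i)
  have hk : k.Injective := fun i j h => (Prod.ext_iff.1 (toLex.injective h)).2
  let C' : Finset (Finset (Fin M)) :=
    Finset.univ.filter fun S => S.Nonempty ∧ ∀ i ∈ S, ∀ j, k j ≤ k i → j ∈ S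
  have hmem : ∀ S, S ∈ C' ↔ S.Nonempty ∧ ∀ i ∈ S, ∀ j, k j ≤ k i → j ∈ S := fun S => by
    simp [C']
  have hC' : IsFlag C' := by
    refine ⟨fun S hS => ((hmem S).1 hS).1, fun S hS T hT => ?_⟩
    by_contra! h
    obtain ⟨i, hi, hi'⟩ := Finset.not_subset.1 h.1
    obtain ⟨j, hj, hj'⟩ := Finset.not_subset.1 h.2
    rcases le_total (k i) (k j) with h | h
    · exact hi' (((hmem T).1 hT).2 j hj i h)
    · exact hj' (((hmem S).1 hS).2 i hi j h)
  have hsub : C ⊆ C' := by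
    intro S hS
    refine (hmem S).2 ⟨hC.nonempty S hS, fun i hi j hji => ?_⟩
    by_contra hj
    have hlt : (C.filter fun T => i ∉ T).card < (C.filter fun T => j ∉ T).card := by
      refine Finset.card_lt_card ((Finset.ssubset_iff_of_subset fun T hT => ?_).2 ⟨S, ?_, ?_⟩)
      · rw [Finset.mem_filter] at hT ⊢
        refine ⟨hT.1, fun hjT => ?_⟩
        rcases hC.comparable S hS T hT.1 with h | h
        · exact hT.2 (h hi)
        · exact hj (h hjT)
      · simp [hS, hj]
      · simp [hi]
    exact absurd hji (not_le.2 (Prod.Lex.toLex_lt_toLex.2 (Or.inl hlt)))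
  refine hC'.exists_isGeneric_of_subset hsub ⟨greedy f k, hf.greedy_pos k, fun S hS => ?_,
    fun S hS hSC => ?_⟩
  · exact (hf.sum_greedy hk S).1 ((hmem S).1 hS).2
  · exact (hf.sum_greedy hk S).2.2 fun h => hSC ((hmem S).2 ⟨hS, h⟩)

/-! ### Faces cut out by chains, and their dimensions. -/

variable {C C' : Finset (Finset (Fin M))}

/-- The polytope of the non-negative vectors dominated by `f`. -/
def polytope (f : Finset (Fin M) → ℝ) : Set (Fin M → ℝ) :=
  {R | (∀ i, 0 ≤ R i) ∧ ∀ S : Finset (Fin M), ∑ i ∈ S, R i ≤ f S}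

/-- The part of the polytope on which the constraints in `C` are tight. -/
def face (f : Finset (Fin M) → ℝ) (C : Finset (Finset (Fin M))) : Set (Fin M → ℝ) :=
  {R | R ∈ polytope f ∧ ∀ S ∈ C, ∑ i ∈ S, R i = f S}

theorem face_insert (S : Finset (Fin M)) : face f (insert S C) = face f C ∩ face f {S} := by
  ext R
  simp only [face, Finset.forall_mem_insert, Set.mem_inter_iff, Set.mem_ofPred_eq,
    Finset.mem_singleton, forall_eq]
  tauto

/-- The inequalities indexed by `C` are added up: equality in the sum forces equality in each term.
-/
theorem isFaceOf_face : IsFaceOf (polytope f) (face f C) := by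
  have hdot : ∀ R : Fin M → ℝ, (R ⬝ᵥ fun i => ∑ S ∈ C, if i ∈ S then (1 : ℝ) else 0) =
      ∑ S ∈ C, ∑ i ∈ S, R i := by
    intro R
    simp only [dotProduct, Finset.mul_sum]
    rw [Finset.sum_comm]
    simp
  refine ⟨fun i => ∑ S ∈ C, if i ∈ S then (1 : ℝ) else 0, ∑ S ∈ C, f S, fun R hR => ?_, ?_⟩
  · rw [hdot]
    exact Finset.sum_le_sum fun S _ => hR.2 S
  · ext R
    simp only [face, Set.mem_inter_iff, Set.mem_ofPred_eq, hdot]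
    refine and_congr_right fun hR => ?_
    rw [Finset.sum_eq_sum_iff_of_le fun S _ => hR.2 S]

theorem IsGeneric.mem_face (hf : StrictPolymatroid f) {p : Fin M → ℝ} (hp : IsGeneric f C p) :
    p ∈ face f C := by
  refine ⟨⟨fun i => (hp.pos i).le, fun S => ?_⟩, hp.sum_eq⟩
  by_cases hS : S ∈ C
  · exact (hp.sum_eq S hS).le
  · rcases S.eq_empty_or_nonempty with rfl | h
    · simp [hf.map_empty]
    · exact (hp.sum_lt S h hS).le

theorem isFlag_of_nonempty_face (hf : StrictPolymatroid f) (hC : ∀ S ∈ C, S.Nonempty)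
    (h : (face f C).Nonempty) : IsFlag C := by
  refine ⟨hC, fun S hS T hT => ?_⟩
  obtain ⟨R, hR, hRC⟩ := h
  by_contra! hST
  have h1 := hf.submodular S T hST.1 hST.2
  have h2 := Finset.sum_union_inter (s₁ := S) (s₂ := T) (f := R)
  linarith [hR.2 (S ∪ T), hR.2 (S ∩ T), hRC S hS, hRC T hT]

theorem IsFlag.subset_of_face_subset (hf : StrictPolymatroid f) (hC : IsFlag C)
    (hC' : ∀ S ∈ C', S.Nonempty) (h : face f C ⊆ face f C') : C' ⊆ C := by
  obtain ⟨p, hp⟩ := hC.exists_isGeneric hf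
  intro S hS
  by_contra hSC
  exact (hp.sum_lt S (hC' S hS) hSC).ne ((h (hp.mem_face hf)).2 S hS)

theorem IsFlag.face_injective (hf : StrictPolymatroid f) (hC : IsFlag C) (hC' : IsFlag C')
    (h : face f C = face f C') : C = C' :=
  (hC'.subset_of_face_subset hf hC.nonempty h.ge).antisymm
    (hC.subset_of_face_subset hf hC'.nonempty h.le)

/-- The directions along which the constraints in `C` stay tight. -/
def tightDirections (C : Finset (Finset (Fin M))) : Submodule ℝ (Fin M → ℝ) where
  carrier := {v | ∀ S ∈ C, ∑ i ∈ S, v i = 0}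
  add_mem' h1 h2 S hS := by simp [Finset.sum_add_distrib, h1 S hS, h2 S hS]
  zero_mem' S _ := by simp
  smul_mem' c v h S hS := by simp [← Finset.mul_sum, h S hS]

theorem mem_tightDirections {v : Fin M → ℝ} :
    v ∈ tightDirections C ↔ ∀ S ∈ C, ∑ i ∈ S, v i = 0 := Iff.rfl

/-- A generic point can move slightly along any direction that keeps `C` tight without leaving the
face. -/
theorem IsFlag.direction_face (hf : StrictPolymatroid f) (hC : IsFlag C) :
    (affineSpan ℝ (face f C)).direction = tightDirections C := by
  rw [direction_affineSpan]
  apply le_antisymm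
  · rw [vectorSpan_def, Submodule.span_le]
    rintro _ ⟨x, hx, y, hy, rfl⟩ S hS
    simp [Finset.sum_sub_distrib, hx.2 S hS, hy.2 S hS]
  · intro v hv
    obtain ⟨p, hp⟩ := hC.exists_isGeneric hf
    obtain ⟨ε, ⟨h1, h2⟩, hε⟩ := ((hp.eventually_perturb v).and self_mem_nhdsWithin).exists
    have hq : IsGeneric f C (p + ε • v) :=
      ⟨h1, fun S hS => by rw [sum_add_smul, hv S hS, hp.sum_eq S hS, mul_zero, add_zero], h2⟩
    have := vsub_mem_vectorSpan ℝ (hq.mem_face hf) (hp.mem_face hf)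
    rw [vsub_eq_sub, add_sub_cancel_left] at this
    exact (Submodule.smul_mem_iff _ (Set.mem_Ioi.1 hε).ne').1 this

theorem IsFlag.insert_univ [Nonempty (Fin M)] (hC : IsFlag C) :
    IsFlag (insert Finset.univ C) := by
  refine ⟨?_, ?_⟩
  · simpa [Finset.univ_nonempty] using hC.nonempty
  · intro S hS T hT
    rw [Finset.mem_insert] at hS hT
    rcases hT with rfl | hT
    · exact Or.inl (Finset.subset_univ _)
    rcases hS with rfl | hS
    · exact Or.inr (Finset.subset_univ _)
    exact hC.comparable S hS T hT

/-- The smaller space is the kernel of the total-sum functional, which is non-zero by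
`IsFlag.exists_direction` applied to the enlarged chain. -/
theorem IsFlag.finrank_tightDirections_insert_univ [Nonempty (Fin M)] (hC : IsFlag C)
    (hu : Finset.univ ∉ C) :
    Module.finrank ℝ (tightDirections (insert Finset.univ C)) + 1 =
      Module.finrank ℝ (tightDirections C) := by
  obtain ⟨v, hv0, hv⟩ := hC.insert_univ.exists_direction (Finset.mem_insert_self _ C)
  have hvC : v ∈ tightDirections C := fun S hS =>
    hv0 S (Finset.mem_insert_of_mem hS) (ne_of_mem_of_not_mem hS hu)
  let φ : Module.Dual ℝ (tightDirections C) :=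
    (∑ i, LinearMap.proj i : (Fin M → ℝ) →ₗ[ℝ] ℝ).comp (tightDirections C).subtype
  have hφ : ∀ w, φ w = ∑ i, (w : Fin M → ℝ) i := fun w => by simp [φ]
  have hφ0 : φ ≠ 0 := fun h => by
    have := hφ ⟨v, hvC⟩
    rw [h] at this
    exact hv.ne this.symm
  have hmap : (LinearMap.ker φ).map (tightDirections C).subtype =
      tightDirections (insert Finset.univ C) := by
    ext w
    simp only [Submodule.mem_map, LinearMap.mem_ker, hφ, Submodule.subtype_apply,
      mem_tightDirections, Finset.forall_mem_insert]
    constructor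
    · rintro ⟨w, h, rfl⟩
      exact ⟨h, w.2⟩
    · rintro ⟨h1, h2⟩
      exact ⟨⟨w, h2⟩, h1, rfl⟩
  rw [← Module.Dual.finrank_ker_add_one_of_ne_zero hφ0, ← hmap,
    (Submodule.equivMapOfInjective _ (tightDirections C).injective_subtype _).finrank_eq]

theorem IsFlag.hasDim_face_iff (hf : StrictPolymatroid f) (hC : IsFlag C) {D : ℤ} :
    HasDim (face f C) D ↔ (Module.finrank ℝ (tightDirections C) : ℤ) = D := by
  obtain ⟨p, hp⟩ := hC.exists_isGeneric hf
  rw [HasDim, hC.direction_face hf, and_iff_right ⟨p, hp.mem_face hf⟩]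

/-- In a non-empty face there is a point at which only the constraints tight on the whole face
are tight. -/
theorem exists_mem_tight_imp {F : Set (Fin M → ℝ)} (hF : IsFaceOf (polytope f) F)
    (hne : F.Nonempty) : ∃ p ∈ F, ∀ S : Finset (Fin M), ∑ i ∈ S, p i = f S →
      ∀ q ∈ F, ∑ i ∈ S, q i = f S := by
  classical
  let t : (Fin M → ℝ) → Finset (Finset (Fin M)) := fun p =>
    Finset.univ.filter fun S => ∑ i ∈ S, p i = f S
  -- Choose `p` with a minimal set of tight constraints. The midpoint of `p` and `q` is tight only
  -- where both are, so minimality makes `q` tight wherever `p` is.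
  obtain ⟨p, hpF, hmin⟩ := exists_minimalFor_of_wellFoundedLT (· ∈ F) t hne
  refine ⟨p, hpF, fun S hS q hq => ?_⟩
  obtain ⟨a, a₀, ha, rfl⟩ := hF
  have hm : (1 / 2 : ℝ) • p + (1 / 2 : ℝ) • q ∈ polytope f ∩ {R | R ⬝ᵥ a = a₀} := by
    refine ⟨⟨fun i => ?_, fun T => ?_⟩, ?_⟩
    · have h1 := hpF.1.1 i
      have h2 := hq.1.1 i
      simp only [Pi.add_apply, Pi.smul_apply, smul_eq_mul]
      linarith
    · have h1 := hpF.1.2 T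
      have h2 := hq.1.2 T
      simp only [Pi.add_apply, Pi.smul_apply, smul_eq_mul, Finset.sum_add_distrib,
        ← Finset.mul_sum]
      linarith
    · have h1 : p ⬝ᵥ a = a₀ := hpF.2
      have h2 : q ⬝ᵥ a = a₀ := hq.2
      simp only [Set.mem_ofPred_eq, add_dotProduct, smul_dotProduct, smul_eq_mul, h1, h2]
      ring
  have hsum : ∀ T, ∑ i ∈ T, ((1 / 2 : ℝ) • p + (1 / 2 : ℝ) • q) i =
      1 / 2 * ∑ i ∈ T, p i + 1 / 2 * ∑ i ∈ T, q i := fun T => by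
    simp [Finset.sum_add_distrib, Finset.mul_sum]
  have hle : t ((1 / 2 : ℝ) • p + (1 / 2 : ℝ) • q) ≤ t p := by
    intro T hT
    simp only [t, Finset.mem_filter, Finset.mem_univ, true_and, hsum] at hT ⊢
    linarith [hpF.1.2 T, hq.1.2 T]
  have hSm : S ∈ t ((1 / 2 : ℝ) • p + (1 / 2 : ℝ) • q) :=
    hmin hm hle (by simp [t, hS])
  simp only [t, Finset.mem_filter, Finset.mem_univ, true_and, hsum] at hSm
  linarith

/-- A face in the dominant facet is cut out by the constraints that are tight on it. -/
theorem exists_eq_face (hf : StrictPolymatroid f) {F : Set (Fin M → ℝ)}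
    (hF : IsFaceOf (polytope f) F) (hne : F.Nonempty) (hdom : F ⊆ face f {Finset.univ}) :
    ∃ C : Finset (Finset (Fin M)), (∀ S ∈ C, S.Nonempty) ∧ F = face f C := by
  classical
  obtain ⟨p, hpF, hp⟩ := exists_mem_tight_imp hF hne
  let C : Finset (Finset (Fin M)) :=
    Finset.univ.filter fun S => S.Nonempty ∧ ∑ i ∈ S, p i = f S
  have hmem : ∀ S, S ∈ C ↔ S.Nonempty ∧ ∑ i ∈ S, p i = f S := fun S => by simp [C]
  obtain ⟨a, a₀, ha, rfl⟩ := hF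
  have hgen : IsGeneric f C p := by
    refine ⟨fun i => ?_, fun S hS => ((hmem S).1 hS).2, fun S hS hSC =>
      (hpF.1.2 S).lt_of_ne fun h => hSC ((hmem S).2 ⟨hS, h⟩)⟩
    -- Positivity: the total is `f [M]`, while the users other than `i` sum to at most `f ([M] \
    -- {i})`, which is smaller.
    have h1 := (hdom hpF).2 _ (Finset.mem_singleton_self _)
    have h2 := Finset.add_sum_erase Finset.univ p (Finset.mem_univ i)
    linarith [hpF.1.2 (Finset.univ.erase i), hf.erase_lt i]
  refine ⟨C, fun S hS => ((hmem S).1 hS).1, Set.Subset.antisymm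
    (fun q hq => ⟨hq.1, fun S hS => hp S ((hmem S).1 hS).2 q hq⟩) fun q hq => ?_⟩
  -- Push `p` slightly away from `q`, staying in the polytope. If `q ⬝ᵥ a < a₀`, the new point would
  -- violate the inequality defining the face.
  obtain ⟨ε, ⟨h1, h2⟩, hε⟩ := ((hgen.eventually_perturb (p - q)).and self_mem_nhdsWithin).exists
  have hg : IsGeneric f C (p + ε • (p - q)) := by
    refine ⟨h1, fun S hS => ?_, h2⟩
    have : ∑ i ∈ S, (p - q) i = 0 := by
      simp [Finset.sum_sub_distrib, hq.2 S hS, hgen.sum_eq S hS]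
    rw [sum_add_smul, this, hgen.sum_eq S hS, mul_zero, add_zero]
  have h3 := ha _ (hg.mem_face hf).1
  have h4 : p ⬝ᵥ a = a₀ := hpF.2
  have h5 := ha q hq.1
  rw [add_dotProduct, smul_dotProduct, sub_dotProduct, h4, smul_eq_mul] at h3
  refine ⟨hq.1, h5.antisymm ?_⟩
  by_contra! h6
  have := mul_pos (Set.mem_Ioi.1 hε) (sub_pos.2 h6)
  linarith

end Polytope

/-! ### Counting the faces of the channel region. -/

section Channel

variable {M : ℕ} {X : Fin M → Type*} {Y : Type*} [∀ i, Fintype (X i)] [Fintype Y]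
  {W : (∀ i, X i) → stdSimplex ℝ Y} {P : ∀ i, stdSimplex ℝ (X i)}

theorem labelled_eq_face (C : Finset (Finset (Fin M))) :
    labelled W P C ∅ = face (fun S => condInfo W P S Sᶜ) C := by
  ext R
  simp only [labelled, face, frontFacet, Set.mem_inter_iff, Set.mem_iInter, Set.mem_ofPred_eq,
    Finset.notMem_empty, IsEmpty.forall_iff, implies_true, and_true]
  exact and_congr_right fun hR => forall₂_congr fun S _ => and_iff_right hR

theorem dominantFacet_eq_face :
    dominantFacet W P = face (fun S => condInfo W P S Sᶜ) {Finset.univ} := by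
  ext R
  simp only [face, Finset.mem_singleton, forall_eq, dominantFacet, frontFacet]
  rfl

theorem mem_frontFaces (hR : NonDegenerated W P) {D : ℤ} {F : Set (Fin M → ℝ)} :
    F ∈ frontFaces W P D ↔ ∃ C, IsFlag C ∧ F = face (fun S => condInfo W P S Sᶜ) C ∧
      (Module.finrank ℝ (tightDirections C) : ℤ) = D := by
  constructor
  · rintro ⟨⟨-, C, hC, rfl⟩, hD⟩
    rw [labelled_eq_face] at hD ⊢
    have hflag := isFlag_of_nonempty_face hR.strictPolymatroid hC hD.1
    exact ⟨C, hflag, rfl, (hflag.hasDim_face_iff hR.strictPolymatroid).1 hD⟩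
  · rintro ⟨C, hC, rfl, hD⟩
    exact ⟨⟨isFaceOf_face, C, hC.nonempty, (labelled_eq_face C).symm⟩,
      (hC.hasDim_face_iff hR.strictPolymatroid).2 hD⟩

theorem frontFaces_finite (D : ℤ) : (frontFaces W P D).Finite := by
  refine (Set.finite_range fun C : Finset (Finset (Fin M)) => labelled W P C ∅).subset ?_
  rintro F ⟨⟨-, C, -, rfl⟩, -⟩
  exact ⟨C, rfl⟩

theorem dominantFaces_eq (hR : NonDegenerated W P) (D : ℤ) :
    dominantFaces W P D = {F ∈ frontFaces W P D | F ⊆ dominantFacet W P} := by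
  ext F
  constructor
  · rintro ⟨hF, hD, hdom⟩
    obtain ⟨C, hC, hFC⟩ := exists_eq_face hR.strictPolymatroid hF hD.1
      (hdom.trans dominantFacet_eq_face.le)
    exact ⟨⟨⟨hF, C, hC, hFC.trans (labelled_eq_face C).symm⟩, hD⟩, hdom⟩
  · rintro ⟨⟨⟨hF, -⟩, hD⟩, hdom⟩
    exact ⟨hF, hD, hdom⟩

theorem IsFlag.face_subset_dominantFacet_iff [Nonempty (Fin M)] (hR : NonDegenerated W P)
    {C : Finset (Finset (Fin M))} (hC : IsFlag C) :
    face (fun S => condInfo W P S Sᶜ) C ⊆ dominantFacet W P ↔ Finset.univ ∈ C := by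
  rw [dominantFacet_eq_face]
  refine ⟨fun h => ?_, fun h R hRC => ⟨hRC.1, by simpa using hRC.2 _ h⟩⟩
  exact hC.subset_of_face_subset hR.strictPolymatroid (by simp [Finset.univ_nonempty]) h
    (Finset.mem_singleton_self _)

theorem inter_dominantFacet_bijOn [Nonempty (Fin M)] (hR : NonDegenerated W P) (D : ℤ) :
    Set.BijOn (· ∩ dominantFacet W P) {F ∈ frontFaces W P D | ¬ F ⊆ dominantFacet W P}
      (dominantFaces W P (D - 1)) := by
  have hf := hR.strictPolymatroid
  rw [dominantFaces_eq hR, dominantFacet_eq_face]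
  simp only [← dominantFacet_eq_face]
  refine ⟨?_, ?_, ?_⟩
  · rintro F ⟨hF, hdom⟩
    obtain ⟨C, hC, rfl, hD⟩ := (mem_frontFaces hR).1 hF
    rw [hC.face_subset_dominantFacet_iff hR] at hdom
    refine ⟨(mem_frontFaces hR).2 ⟨insert Finset.univ C, hC.insert_univ, ?_, ?_⟩,
      Set.inter_subset_right⟩
    · rw [face_insert, dominantFacet_eq_face]
    · have := hC.finrank_tightDirections_insert_univ hdom
      omega
  · rintro F ⟨hF, hdom⟩ G ⟨hG, hdom'⟩ hFG
    obtain ⟨C, hC, rfl, -⟩ := (mem_frontFaces hR).1 hF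
    obtain ⟨C', hC', rfl, -⟩ := (mem_frontFaces hR).1 hG
    rw [hC.face_subset_dominantFacet_iff hR] at hdom
    rw [hC'.face_subset_dominantFacet_iff hR] at hdom'
    simp only [dominantFacet_eq_face, ← face_insert] at hFG
    have := hC.insert_univ.face_injective hf hC'.insert_univ hFG
    rw [← Finset.erase_insert hdom, this, Finset.erase_insert hdom']
  · rintro G ⟨hG, hdom⟩
    obtain ⟨C, hC, rfl, hD⟩ := (mem_frontFaces hR).1 hG
    rw [hC.face_subset_dominantFacet_iff hR] at hdom
    have hC' := hC.mono (Finset.erase_subset Finset.univ C)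
    have hn := Finset.notMem_erase Finset.univ C
    have hins := Finset.insert_erase hdom
    refine ⟨face _ (C.erase Finset.univ), ⟨(mem_frontFaces hR).2 ⟨_, hC', rfl, ?_⟩, ?_⟩, ?_⟩
    · have := hC'.finrank_tightDirections_insert_univ hn
      rw [hins] at this
      omega
    · rwa [hC'.face_subset_dominantFacet_iff hR]
    · simp only [dominantFacet_eq_face]
      rw [← face_insert, hins]

theorem ncard_frontFaces_not_subset (hR : NonDegenerated W P) {D : ℕ} (hD : D ≤ M) :
    {F ∈ frontFaces W P D | ¬ F ⊆ dominantFacet W P}.ncard =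
      numDominant W P ((D : ℤ) - 1) := by
  rcases isEmpty_or_nonempty (Fin M) with h | h
  -- For `M = 0` the set `[M]` is empty and cannot belong to a chain of non-empty sets. Here `D =
  -- 0`, every front face lies in the dominant facet, and no face has dimension `-1`.
  · obtain rfl : M = 0 := Nat.eq_zero_of_not_pos fun h0 => h.false ⟨0, h0⟩
    have h1 : {F ∈ frontFaces W P D | ¬ F ⊆ dominantFacet W P} = ∅ := by
      refine Set.eq_empty_of_forall_notMem fun F ⟨hF, hdom⟩ => hdom ?_
      obtain ⟨C, -, rfl, -⟩ := (mem_frontFaces hR).1 hF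
      rw [dominantFacet_eq_face]
      refine fun R hRC => ⟨hRC.1, fun S _ => ?_⟩
      rw [Finset.eq_empty_of_isEmpty S]
      exact hR.strictPolymatroid.map_empty.symm
    have h2 : dominantFaces W P ((D : ℤ) - 1) = ∅ := by
      refine Set.eq_empty_of_forall_notMem fun F hF => ?_
      have := hF.2.1.2
      omega
    rw [numDominant, h1, h2]
  · exact (inter_dominantFacet_bijOn hR D).ncard_eq

end Channel

end MACRegion

theorem mainTheorem5 {M : ℕ} {X : Fin M → Type*} {Y : Type*} [∀ i, Fintype (X i)] [Fintype Y]
    (W : (∀ i, X i) → stdSimplex ℝ Y) (P : ∀ i, stdSimplex ℝ (X i))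
    (hR : MACRegion.NonDegenerated W P) (D : ℕ) (hD : D ≤ M) :
    (MACRegion.frontFaces W P D).Finite ∧
    (MACRegion.dominantFaces W P D).Finite ∧
    (MACRegion.dominantFaces W P ((D : ℤ) - 1)).Finite ∧
    {F ∈ MACRegion.frontFaces W P D | F ⊆ MACRegion.dominantFacet W P}.ncard =
      MACRegion.numDominant W P D ∧
    {F ∈ MACRegion.frontFaces W P D | ¬ F ⊆ MACRegion.dominantFacet W P}.ncard =
      MACRegion.numDominant W P ((D : ℤ) - 1) ∧
    MACRegion.numFront W P D =
      MACRegion.numDominant W P D + MACRegion.numDominant W P ((D : ℤ) - 1) := by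
  have hfin : ∀ k : ℤ, (MACRegion.dominantFaces W P k).Finite := fun k => by
    rw [MACRegion.dominantFaces_eq hR]
    exact (MACRegion.frontFaces_finite k).subset (Set.sep_subset _ _)
  have h1 : {F ∈ MACRegion.frontFaces W P D | F ⊆ MACRegion.dominantFacet W P}.ncard =
      MACRegion.numDominant W P D := by
    rw [MACRegion.numDominant, MACRegion.dominantFaces_eq hR]
  have h2 := MACRegion.ncard_frontFaces_not_subset hR hD
  refine ⟨MACRegion.frontFaces_finite _, hfin _, hfin _, h1, h2, ?_⟩
  have hdisj : Disjoint {F ∈ MACRegion.frontFaces W P D | F ⊆ MACRegion.dominantFacet W P}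
      {F ∈ MACRegion.frontFaces W P D | ¬ F ⊆ MACRegion.dominantFacet W P} :=
    Set.disjoint_left.2 fun F hF hF' => hF'.2 hF.2
  rw [← h1, ← h2, MACRegion.numFront, ← Set.ncard_union_eq hdisj
    ((MACRegion.frontFaces_finite _).subset (Set.sep_subset _ _))
    ((MACRegion.frontFaces_finite _).subset (Set.sep_subset _ _))]
  congr 1
  ext F
  simp only [Set.mem_union, Set.mem_ofPred_eq]
  tauto
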